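/- Let $k_1,k_2,k_3\in\mathbb Z_{\ge 0}$. Let $\mathcal A(k_1,k_2,k_3)$ be the generalized cluster algebra with trivial coefficients (in the sense of Chekhov--Shapiro and Nakanishi) whose initial seed has cluster $(x_1,x_2,x_3)$, exchange polynomials $Z_j(u)=1+u$ if $k_j=0$ and $Z_j(u)=1+k_ju+u^2$ if $k_j\neq 0$, and exchange matrix obtained from $\begin{bmatrix}0&-1&1\\1&0&-1\\-1&1&0\end{bmatrix}$ by doubling the $j$-th column for each $j$ with $k_j=0$. (The mutation of a labeled cluster in direction $i$ thus replaces its $i$-th component $y_i$ by $(y_j^2+k_iy_jy_h+y_h^2)/y_i$, where $\{i,j,h\}=\{1,2,3\}$.) A non-labeled cluster is a triple $(a,b,c)$ obtained by permuting the components of a labeled cluster. The position $i\in\{1,2,3\}$ at which a cluster variable $z$ occurs in labeled clusters is uniquely determined by $z$; put $k_z:=k_i$. For a Laurent polynomial $f\in L:=\mathbb Z[x_1^{\pm1},x_2^{\pm1},x_3^{\pm1}]$ put $|f|:=f|_{x_1=x_2=x_3=1}$. Let $$\mathscr M=\frac{x_1^2+x_2^2+x_3^2+k_1x_2x_3+k_2x_1x_3+k_3x_1x_2}{x_1x_2x_3},\qquad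 T=\begin{bmatrix}-1&0\\ \mathscr M&-1\end{bmatrix}.$$ A CGC (cluster generalized Cohn) matrix is a matrix $P\in SL(2,L)$ whose $(1,2)$-entry $p_{12}$ is a cluster variable of $\mathcal A(k_1,k_2,k_3)$ and which satisfies $\operatorname{tr}(P)=\mathscr M p_{12}-k_{p_{12}}$. A CGC triple associated with a non-labeled cluster $(a,b,c)$ is a triple $(P,Q,R)$ of CGC matrices with $(p_{12},q_{12},r_{12})=(a,b,c)$ and $Q=PR-S_Q$, where $S_Q=s\begin{bmatrix}1&0\\ \mathscr M&1\end{bmatrix}$ with $s=\mathscr M q_{12}-\operatorname{tr}(Q)$. A CMM (cluster Markov-monodromy) matrix is a matrix $X\in SL(2,L)$ whose $(1,2)$-entry $x_{12}$ is a cluster variable of $\mathcal A(k_1,k_2,k_3)$ and which satisfies $\operatorname{tr}(X)=-k_{x_{12}}$. A CMM triple is a triple $(X,Y,Z)$ of CMM matrices such that $XYZ=T$ and the triple $(x_{12},y_{12},z_{12})$ of their $(1,2)$-entries is a non-labeled cluster. A Markov-monodromy decomposition of a CGC triple $(P,Q,R)$ associated with $(a,b,c)$ is a triple $(X,Y,Z)$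 such that 1. $(X,Y,Z)$ is a CMM triple; 2. $P=-(YZ)^{-1}$, $Q=-(XZ)^{-1}$, $R=-(XY)^{-1}$; 3. $\operatorname{tr}(X)=-k_a$, $\operatorname{tr}(Y)=-k_b$, $\operatorname{tr}(Z)=-k_c$. **Theorem.** If $(P,Q,R)$ is a CGC triple associated with a non-labeled cluster $(a,b,c)$ such that $|b|>\max\{|a|,|c|\}$, then there exists a unique Markov-monodromy decomposition $(X,Y,Z)$ of $(P,Q,R)$. -/

import Mathlib

namespace GenMarkov

/-! ### Generalized seeds with trivial coefficients and their mutation -/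

/-- The data of a labeled seed of rank `n` over the trivial semifield `{1}` (so that all the
coefficients are `1` and are omitted): a cluster, an exchange matrix, and exchange polynomials
with nonnegative integer coefficients. -/
@[ext]
structure Seed (n : ℕ) (F : Type*) where
  x : Fin n → F
  B : Matrix (Fin n) (Fin n) ℤ
  Z : Fin n → Polynomial ℕ

/-- The degree `d_k` of the `k`-th exchange polynomial. -/
noncomputable def Seed.d {n : ℕ} {F : Type*} (s : Seed n F) (k : Fin n) : ℕ :=
  (s.Z k).natDegree

/-- Mutation of a labeled seed in direction `k`. Here `[b]_+ = max b 0`; the polynomial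
`u ^ d_k * Z_k (1 / u)` is `Polynomial.reverse`, and the value of `Z_k` at `1` in the trivial
semifield, by which the general formula divides, is `1`. -/
noncomputable def Seed.mutate {n : ℕ} {F : Type*} [Field F] (s : Seed n F) (k : Fin n) :
    Seed n F where
  x := Function.update s.x k
    ((s.x k)⁻¹ * (∏ i, s.x i ^ max (-(s.B i k)) 0) ^ s.d k
      * (s.Z k).eval₂ (Nat.castRingHom F) (∏ i, s.x i ^ s.B i k))
  B := Matrix.of fun i j =>
    if i = k ∨ j = k then -(s.B i j)
    else s.B i j + (s.d k : ℤ) * (max (s.B i k) 0 * s.B k j + s.B i k * max (-(s.B k j)) 0)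
  Z := Function.update s.Z k (s.Z k).reverse

/-- The labeled seeds of the generalized cluster pattern with initial seed `s₀`: those obtained
from `s₀` by finitely many mutations. -/
inductive Seed.InPattern {n : ℕ} {F : Type*} [Field F] (s₀ : Seed n F) : Seed n F → Prop
  | init : Seed.InPattern s₀ s₀
  | mutate (s : Seed n F) (k : Fin n) : Seed.InPattern s₀ s → Seed.InPattern s₀ (s.mutate k)

/-! ### Laurent polynomials in three variables -/

/-- The ring `ℤ[x₁^{±1}, x₂^{±1}, x₃^{±1}]`, as the group ring of `ℤ³`.
The indices `1, 2, 3` are `0, 1, 2 : Fin 3`. -/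
abbrev Laurent : Type := AddMonoidAlgebra ℤ (Fin 3 → ℤ)

/-- The Laurent monomial with exponent vector `e`. -/
noncomputable def monomial (e : Fin 3 → ℤ) : Laurent := AddMonoidAlgebra.single e 1

/-- The variable `x_i`. -/
noncomputable def var (i : Fin 3) : Laurent := monomial (Pi.single i 1)

/-- The specialization `|f| = f|_{x₁ = x₂ = x₃ = 1}`, a ring homomorphism. -/
noncomputable def atOne : Laurent →+* ℤ :=
  (AddMonoidAlgebra.lift ℤ ℤ (Fin 3 → ℤ) (1 : Multiplicative (Fin 3 → ℤ) →* ℤ)).toRingHom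

/-- The field of rational functions `ℚ(x₁, x₂, x₃)`, as the fraction field of `Laurent`. -/
abbrev RatFun : Type := FractionRing Laurent

/-! ### The generalized Markov cluster algebra `𝒜(k₁, k₂, k₃)` -/

/-- The exchange polynomial `1 + u` if `κ = 0`, and `1 + κ u + u²` otherwise. -/
noncomputable def exchangePoly (κ : ℕ) : Polynomial ℕ :=
  if κ = 0 then 1 + Polynomial.X
  else 1 + Polynomial.C κ * Polynomial.X + Polynomial.X ^ 2

/-- The initial exchange matrix: the matrix `!![0, -1, 1; 1, 0, -1; -1, 1, 0]`, with the `j`-th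
column multiplied by `2` for each `j` with `k_j = 0`. -/
def initialB (k : Fin 3 → ℕ) : Matrix (Fin 3) (Fin 3) ℤ :=
  Matrix.of fun i j =>
    (!![0, -1, 1; 1, 0, -1; -1, 1, 0] : Matrix (Fin 3) (Fin 3) ℤ) i j * (if k j = 0 then 2 else 1)

/-- The initial seed of `𝒜(k₁, k₂, k₃)`. -/
noncomputable def initialSeed (k : Fin 3 → ℕ) : Seed 3 RatFun where
  x := fun i => algebraMap Laurent RatFun (var i)
  B := initialB k
  Z := fun i => exchangePoly (k i)

/-- `z` is a cluster variable at position `i`: the `i`-th component of some labeled cluster. -/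
def IsClusterVariableAt (k : Fin 3 → ℕ) (i : Fin 3) (z : RatFun) : Prop :=
  ∃ s : Seed 3 RatFun, (initialSeed k).InPattern s ∧ s.x i = z

/-- `z` is a cluster variable of `𝒜(k₁, k₂, k₃)`. -/
def IsClusterVariable (k : Fin 3 → ℕ) (z : RatFun) : Prop :=
  ∃ i, IsClusterVariableAt k i z

/-- `(a, b, c)` is a non-labeled cluster: a permutation of a labeled cluster. -/
def IsNonlabeledCluster (k : Fin 3 → ℕ) (a b c : RatFun) : Prop :=
  ∃ s : Seed 3 RatFun, (initialSeed k).InPattern s ∧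
    ∃ σ : Equiv.Perm (Fin 3), s.x (σ 0) = a ∧ s.x (σ 1) = b ∧ s.x (σ 2) = c

open Classical in
/-- The parity `k_z` of a cluster variable `z`: it is `k_i` where `i` is the position of `z` in a
labeled cluster (and `0` if `z` is not a cluster variable). -/
noncomputable def parity (k : Fin 3 → ℕ) (z : RatFun) : ℕ :=
  if h : IsClusterVariable k z then k h.choose else 0

/-- The generalized Markov invariant
`(x₁² + x₂² + x₃² + k₁ x₂ x₃ + k₂ x₁ x₃ + k₃ x₁ x₂) / (x₁ x₂ x₃)`. -/
noncomputable def markovInvariant (k : Fin 3 → ℕ) : Laurent :=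
  (var 0 ^ 2 + var 1 ^ 2 + var 2 ^ 2 + (k 0 : Laurent) * var 1 * var 2
    + (k 1 : Laurent) * var 0 * var 2 + (k 2 : Laurent) * var 0 * var 1)
    * monomial (fun _ => -1)

/-! ### Cluster generalized Cohn and cluster Markov-monodromy triples -/

/-- The group `SL(2, ℤ[x₁^{±1}, x₂^{±1}, x₃^{±1}])`. -/
abbrev SL2 : Type := Matrix.SpecialLinearGroup (Fin 2) Laurent

/-- The `(1,2)`-entry of a matrix, as a rational function. -/
noncomputable def entry12 (P : SL2) : RatFun :=
  algebraMap Laurent RatFun ((P : Matrix (Fin 2) (Fin 2) Laurent) 0 1)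

/-- `(k₁, k₂, k₃)`-cluster generalized Cohn matrices (CGC matrices). -/
structure IsCGCMatrix (k : Fin 3 → ℕ) (P : SL2) : Prop where
  isClusterVariable : IsClusterVariable k (entry12 P)
  trace_eq : (P : Matrix (Fin 2) (Fin 2) Laurent).trace
    = markovInvariant k * (P : Matrix (Fin 2) (Fin 2) Laurent) 0 1
      - (parity k (entry12 P) : Laurent)

/-- The matrix `S_P`. -/
noncomputable def matS (k : Fin 3 → ℕ) (P : Matrix (Fin 2) (Fin 2) Laurent) :
    Matrix (Fin 2) (Fin 2) Laurent :=
  !![markovInvariant k * P 0 1 - P.trace, 0;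
     (markovInvariant k * P 0 1 - P.trace) * markovInvariant k,
       markovInvariant k * P 0 1 - P.trace]

/-- `(k₁, k₂, k₃)`-cluster generalized Cohn triples (CGC triples). -/
structure IsCGCTriple (k : Fin 3 → ℕ) (P Q R : SL2) : Prop where
  left : IsCGCMatrix k P
  middle : IsCGCMatrix k Q
  right : IsCGCMatrix k R
  eq_mul_sub : (Q : Matrix (Fin 2) (Fin 2) Laurent)
    = (P : Matrix (Fin 2) (Fin 2) Laurent) * (R : Matrix (Fin 2) (Fin 2) Laurent)
      - matS k (Q : Matrix (Fin 2) (Fin 2) Laurent)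
  isCluster : IsNonlabeledCluster k (entry12 P) (entry12 Q) (entry12 R)

/-- The CGC triple `(P, Q, R)` is associated with the non-labeled cluster `(a, b, c)`. -/
structure IsCGCTripleAssociated (k : Fin 3 → ℕ) (P Q R : SL2) (a b c : Laurent) : Prop where
  isCGCTriple : IsCGCTriple k P Q R
  left_eq : (P : Matrix (Fin 2) (Fin 2) Laurent) 0 1 = a
  middle_eq : (Q : Matrix (Fin 2) (Fin 2) Laurent) 0 1 = b
  right_eq : (R : Matrix (Fin 2) (Fin 2) Laurent) 0 1 = c

/-- `(k₁, k₂, k₃)`-cluster Markov-monodromy matrices (CMM matrices). -/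
structure IsCMMMatrix (k : Fin 3 → ℕ) (X : SL2) : Prop where
  isClusterVariable : IsClusterVariable k (entry12 X)
  trace_eq : (X : Matrix (Fin 2) (Fin 2) Laurent).trace = -(parity k (entry12 X) : Laurent)

/-- `(k₁, k₂, k₃)`-cluster Markov-monodromy triples (CMM triples). -/
structure IsCMMTriple (k : Fin 3 → ℕ) (X Y Z : SL2) : Prop where
  left : IsCMMMatrix k X
  middle : IsCMMMatrix k Y
  right : IsCMMMatrix k Z
  mul_eq : ((X * Y * Z : SL2) : Matrix (Fin 2) (Fin 2) Laurent)
    = !![-1, 0; markovInvariant k, -1]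
  isCluster : IsNonlabeledCluster k (entry12 X) (entry12 Y) (entry12 Z)

/-- `(X, Y, Z)` is a Markov-monodromy decomposition of the triple `(P, Q, R)`, associated with
`(a, b, c)`. -/
structure IsMMDecomposition (k : Fin 3 → ℕ) (P Q R : SL2) (a b c : Laurent) (X Y Z : SL2) :
    Prop where
  isCMMTriple : IsCMMTriple k X Y Z
  left_eq : P = -(Y * Z)⁻¹
  middle_eq : Q = -(X * Z)⁻¹
  right_eq : R = -(X * Y)⁻¹
  trace_left : (X : Matrix (Fin 2) (Fin 2) Laurent).trace
    = -(parity k (algebraMap Laurent RatFun a) : Laurent)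
  trace_middle : (Y : Matrix (Fin 2) (Fin 2) Laurent).trace
    = -(parity k (algebraMap Laurent RatFun b) : Laurent)
  trace_right : (Z : Matrix (Fin 2) (Fin 2) Laurent).trace
    = -(parity k (algebraMap Laurent RatFun c) : Laurent)

end GenMarkov

/-! The equations `XYZ = T`, `P = -(YZ)⁻¹`, `R = -(XY)⁻¹` force `X = -TP`, `Z = -RT`, `Y = (RTP)⁻¹`,
which gives uniqueness (`IsMMDecomposition.eq`). For existence, multiplying by `-T` on either side
keeps the (1,2)-entry and lowers the trace by `M` times it, so CGC matrices become CMM matrices. The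
(1,2)-entry of `Y` is `M a c - k_a c - k_c a - b`. Since all clusters satisfy one Markov-type
equation, this is the other root of the quadratic solved by `b`, hence its mutation, and the entries
form the mutated cluster. The formula for `Q` is Cayley–Hamilton for `TQ`. That `k_z` is well
defined needs an argument: along `x_i = t ^ w i`, exchange numerators are subtraction-free and grow
with even exponent, so a variable at position `i` has growth exponent congruent to `w i` mod 2,
which detects `i`. -/

namespace GenMarkov

open Filter Topology

/-! ### Growth of Laurent polynomials along one-parameter curves -/

/-- Evaluation of a Laurent polynomial at the point `(t ^ w 0, t ^ w 1, t ^ w 2)`. -/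
noncomputable def evalCurve (w : Fin 3 → ℤ) (t : ℝˣ) : Laurent →+* ℝ :=
  (AddMonoidAlgebra.lift ℤ ℝ (Fin 3 → ℤ)
    { toFun := fun e => ((t ^ (∑ i, w i * (Multiplicative.toAdd e) i) : ℝˣ) : ℝ)
      map_one' := by simp
      map_mul' := fun e f => by
        simp [mul_add, Finset.sum_add_distrib, zpow_add] }).toRingHom

theorem evalCurve_var (w : Fin 3 → ℤ) (t : ℝˣ) (i : Fin 3) :
    evalCurve w t (var i) = (t : ℝ) ^ w i := by
  simp [evalCurve, var, monomial, Pi.single_apply]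

/-- The unit `exp n` of `ℝ`, which tends to infinity with `n`. -/
noncomputable def expUnit (n : ℕ) : ℝˣ := Units.mk0 (Real.exp n) (Real.exp_ne_zero _)

theorem expUnit_zpow (n : ℕ) (d : ℤ) : ((expUnit n : ℝˣ) : ℝ) ^ d = Real.exp (d * n) := by
  rw [expUnit, Units.val_mk0, mul_comm, Real.exp_mul, Real.rpow_intCast]

/-- Along the curve with weights `w`, the Laurent polynomial `p` grows like a positive multiple of
`t ^ d`. -/
def Grows (w : Fin 3 → ℤ) (p : Laurent) (d : ℤ) : Prop :=
  ∃ c : ℝ, 0 < c ∧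
    Tendsto (fun n : ℕ => evalCurve w (expUnit n) p * Real.exp (-(d * n))) atTop (𝓝 c)

theorem tendsto_exp_neg_mul {m : ℤ} (hm : 0 < m) :
    Tendsto (fun n : ℕ => Real.exp (-((m : ℝ) * n))) atTop (𝓝 0) := by
  refine Real.tendsto_exp_neg_atTop_nhds_zero.comp ?_
  exact tendsto_natCast_atTop_atTop.const_mul_atTop (by exact_mod_cast hm)

theorem Grows.var (w : Fin 3 → ℤ) (i : Fin 3) : Grows w (var i) (w i) := by
  refine ⟨1, one_pos, ?_⟩
  simp [evalCurve_var, expUnit_zpow, ← Real.exp_add]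

theorem Grows.natCast (w : Fin 3 → ℤ) {m : ℕ} (hm : 0 < m) : Grows w (m : Laurent) 0 :=
  ⟨m, by exact_mod_cast hm, by simp⟩

theorem Grows.mul {w : Fin 3 → ℤ} {p q : Laurent} {d e : ℤ} (hp : Grows w p d)
    (hq : Grows w q e) : Grows w (p * q) (d + e) := by
  obtain ⟨c, hc, hp⟩ := hp
  obtain ⟨c', hc', hq⟩ := hq
  refine ⟨c * c', mul_pos hc hc', (hp.mul hq).congr fun n => ?_⟩
  have : Real.exp (-(((d + e : ℤ) : ℝ) * n)) = Real.exp (-(d * n)) * Real.exp (-(e * n)) := by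
    rw [← Real.exp_add]; push_cast; ring_nf
  rw [this, map_mul]; ring

theorem Grows.tendsto_zero {w : Fin 3 → ℤ} {p : Laurent} {d e : ℤ} (hp : Grows w p d)
    (h : d < e) :
    Tendsto (fun n : ℕ => evalCurve w (expUnit n) p * Real.exp (-(e * n))) atTop (𝓝 0) := by
  obtain ⟨c, hc, hp⟩ := hp
  have := hp.mul (tendsto_exp_neg_mul (sub_pos.2 h))
  rw [mul_zero] at this
  refine this.congr fun n => ?_
  rw [mul_assoc, ← Real.exp_add]; push_cast; ring_nf

/-- Both leading constants are positive, so nothing cancels and the exponent is exactly the maximum,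
even when `d = e`. -/
theorem Grows.add {w : Fin 3 → ℤ} {p q : Laurent} {d e : ℤ} (hp : Grows w p d)
    (hq : Grows w q e) : Grows w (p + q) (max d e) := by
  rcases lt_trichotomy d e with h | rfl | h
  · rw [max_eq_right h.le]
    have h0 := hp.tendsto_zero h
    obtain ⟨c, hc, hq⟩ := hq
    refine ⟨c, hc, ?_⟩
    simpa [add_mul] using h0.add hq
  · obtain ⟨c, hc, hp⟩ := hp
    obtain ⟨c', hc', hq⟩ := hq
    rw [max_self]
    refine ⟨c + c', add_pos hc hc', ?_⟩
    simpa [add_mul] using hp.add hq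
  · rw [max_eq_left h.le]
    have h0 := hq.tendsto_zero h
    obtain ⟨c, hc, hp⟩ := hp
    refine ⟨c, hc, ?_⟩
    simpa [add_mul] using hp.add h0

theorem Grows.unique {w : Fin 3 → ℤ} {p : Laurent} {d e : ℤ} (hp : Grows w p d)
    (hq : Grows w p e) : d = e := by
  by_contra hne
  rcases lt_or_gt_of_ne hne with h | h
  · obtain ⟨c, hc, hq⟩ := hq
    exact hc.ne (tendsto_nhds_unique (hp.tendsto_zero h) hq)
  · obtain ⟨c, hc, hp⟩ := hp
    exact hc.ne (tendsto_nhds_unique (hq.tendsto_zero h) hp)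

theorem Grows.ne_zero {w : Fin 3 → ℤ} {p : Laurent} {d : ℤ} (hp : Grows w p d) : p ≠ 0 := by
  rintro rfl
  obtain ⟨c, hc, hp⟩ := hp
  simp only [map_zero, zero_mul] at hp
  exact hc.ne (tendsto_nhds_unique tendsto_const_nhds hp)

/-! ### Growth of rational functions -/

theorem Grows.algebraMap_ne_zero {w : Fin 3 → ℤ} {p : Laurent} {d : ℤ}
    (hp : Grows w p d) : algebraMap Laurent RatFun p ≠ 0 :=
  fun h => hp.ne_zero (IsFractionRing.injective Laurent RatFun (by rw [h, map_zero]))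

/-- The rational function `z` is a quotient of Laurent polynomials with growth, and its own growth
has exponent `d`. -/
def RatGrows (w : Fin 3 → ℤ) (z : RatFun) (d : ℤ) : Prop :=
  ∃ (p q : Laurent) (e f : ℤ), Grows w p e ∧ Grows w q f ∧ d = e - f ∧
    z = algebraMap Laurent RatFun p / algebraMap Laurent RatFun q

theorem Grows.ratGrows {w : Fin 3 → ℤ} {p : Laurent} {d : ℤ} (hp : Grows w p d) :
    RatGrows w (algebraMap Laurent RatFun p) d :=
  ⟨p, 1, d, 0, hp, by simpa using Grows.natCast w one_pos, by simp, by simp⟩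

theorem RatGrows.ne_zero {w : Fin 3 → ℤ} {z : RatFun} {d : ℤ} (hz : RatGrows w z d) :
    z ≠ 0 := by
  obtain ⟨p, q, e, f, hp, hq, -, rfl⟩ := hz
  exact div_ne_zero hp.algebraMap_ne_zero hq.algebraMap_ne_zero

theorem RatGrows.mul {w : Fin 3 → ℤ} {y z : RatFun} {d e : ℤ} (hy : RatGrows w y d)
    (hz : RatGrows w z e) : RatGrows w (y * z) (d + e) := by
  obtain ⟨p, q, d₁, d₂, hp, hq, rfl, rfl⟩ := hy
  obtain ⟨p', q', e₁, e₂, hp', hq', rfl, rfl⟩ := hz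
  exact ⟨p * p', q * q', _, _, hp.mul hp', hq.mul hq', by ring,
    by rw [map_mul, map_mul, div_mul_div_comm]⟩

theorem RatGrows.inv {w : Fin 3 → ℤ} {z : RatFun} {d : ℤ} (hz : RatGrows w z d) :
    RatGrows w z⁻¹ (-d) := by
  obtain ⟨p, q, e, f, hp, hq, rfl, rfl⟩ := hz
  exact ⟨q, p, f, e, hq, hp, by ring, by rw [inv_div]⟩

theorem RatGrows.add {w : Fin 3 → ℤ} {y z : RatFun} {d e : ℤ} (hy : RatGrows w y d)
    (hz : RatGrows w z e) : RatGrows w (y + z) (max d e) := by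
  obtain ⟨p, q, d₁, d₂, hp, hq, rfl, rfl⟩ := hy
  obtain ⟨p', q', e₁, e₂, hp', hq', rfl, rfl⟩ := hz
  refine ⟨p * q' + q * p', q * q', _, _, (hp.mul hq').add (hq.mul hp'), hq.mul hq', by omega, ?_⟩
  rw [div_add_div _ _ hq.algebraMap_ne_zero hq'.algebraMap_ne_zero]
  simp only [map_mul, map_add]

theorem RatGrows.unique {w : Fin 3 → ℤ} {z : RatFun} {d e : ℤ} (hd : RatGrows w z d)
    (he : RatGrows w z e) : d = e := by
  obtain ⟨p, q, d₁, d₂, hp, hq, rfl, rfl⟩ := hd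
  obtain ⟨p', q', e₁, e₂, hp', hq', rfl, h⟩ := he
  rw [div_eq_div_iff hq.algebraMap_ne_zero hq'.algebraMap_ne_zero, ← map_mul, ← map_mul] at h
  have h := IsFractionRing.injective Laurent RatFun h
  have := (hp.mul hq').unique (h ▸ hp'.mul hq)
  omega

/-- The right-hand side of an exchange relation grows with an even exponent. -/
theorem RatGrows.exchange {w : Fin 3 → ℤ} {y z : RatFun} {d e : ℤ} (hy : RatGrows w y d)
    (hz : RatGrows w z e) (κ : ℕ) :
    RatGrows w (y ^ 2 + κ * (y * z) + z ^ 2) (2 * max d e) := by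
  have h2 : RatGrows w (y ^ 2 + z ^ 2) (2 * max d e) := by
    convert (hy.mul hy).add (hz.mul hz) using 1
    · ring
    · omega
  -- The zero function has no growth exponent. For `κ > 0` the cross term has exponent `d + e ≤ 2 *
  -- max d e`.
  rcases Nat.eq_zero_or_pos κ with rfl | hκ
  · simpa using h2
  · have hk : RatGrows w (κ : RatFun) 0 := by
      simpa using (Grows.natCast w hκ).ratGrows
    convert h2.add (hk.mul (hy.mul hz)) using 1
    · ring
    · omega

/-! ### The seeds of the pattern -/

theorem natDegree_exchangePoly (κ : ℕ) :
    (exchangePoly κ).natDegree = if κ = 0 then 1 else 2 := by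
  unfold exchangePoly
  split_ifs <;> compute_degree!

/-- The polynomials are palindromic, so mutation leaves them unchanged. -/
theorem reverse_exchangePoly (κ : ℕ) : (exchangePoly κ).reverse = exchangePoly κ := by
  ext n
  rw [Polynomial.reverse, natDegree_exchangePoly, Polynomial.coeff_reflect, Polynomial.revAt]
  unfold exchangePoly
  split_ifs <;> rcases n with _ | _ | _ | n <;>
    simp [Polynomial.coeff_one, Polynomial.coeff_X]

/-- Doubled columns compensate for degree 1: off the diagonal, `|b_ai| * d_i = 2`. As the signs form
an oriented 3-cycle, the correction to an entry `b` away from row and column `i` is `-2b`. -/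
theorem mutate_initialB {k : Fin 3 → ℕ} {s : Seed 3 RatFun}
    (hZ : s.Z = fun i => exchangePoly (k i))
    (hB : s.B = initialB k ∨ s.B = -initialB k) (i : Fin 3) : (s.mutate i).B = -s.B := by
  have hd : s.d i = if k i = 0 then 1 else 2 := by
    rw [Seed.d, hZ, natDegree_exchangePoly]
  ext a b
  simp only [Seed.mutate, hd, Matrix.of_apply, Matrix.neg_apply]
  rcases hB with hB | hB <;> rw [hB] <;>
  fin_cases i <;> fin_cases a <;> fin_cases b <;>
    simp [initialB] <;> split_ifs <;> simp

theorem prod_zpow_initialB {F : Type*} [Field F] (k : Fin 3 → ℕ) (x : Fin 3 → F) (i : Fin 3) :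
    ∏ a, x a ^ initialB k a i
      = x (i + 1) ^ (if k i = 0 then 2 else 1 : ℤ) / x (i + 2) ^ (if k i = 0 then 2 else 1 : ℤ) := by
  rw [div_eq_mul_inv, ← zpow_neg]
  fin_cases i <;> simp [initialB, Fin.prod_univ_three] <;> split_ifs <;> simp [mul_comm]

theorem prod_zpow_max_neg_initialB {F : Type*} [Field F] (k : Fin 3 → ℕ) (x : Fin 3 → F)
    (i : Fin 3) :
    ∏ a, x a ^ max (-initialB k a i) 0 = x (i + 2) ^ (if k i = 0 then 2 else 1 : ℤ) := by
  fin_cases i <;> simp [initialB, Fin.prod_univ_three] <;> split_ifs <;> simp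

theorem prod_zpow_max_initialB {F : Type*} [Field F] (k : Fin 3 → ℕ) (x : Fin 3 → F)
    (i : Fin 3) :
    ∏ a, x a ^ max (initialB k a i) 0 = x (i + 1) ^ (if k i = 0 then 2 else 1 : ℤ) := by
  fin_cases i <;> simp [initialB, Fin.prod_univ_three] <;> split_ifs <;> simp

/-- Homogenization of the exchange polynomials. -/
theorem pow_mul_eval₂_exchangePoly {F : Type*} [Field F] (κ : ℕ) (y : F) {z : F} (hz : z ≠ 0) :
    (z ^ (if κ = 0 then 2 else 1 : ℤ)) ^ (if κ = 0 then 1 else 2)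
      * (exchangePoly κ).eval₂ (Nat.castRingHom F)
        (y ^ (if κ = 0 then 2 else 1 : ℤ) / z ^ (if κ = 0 then 2 else 1 : ℤ))
      = y ^ 2 + κ * (y * z) + z ^ 2 := by
  by_cases hκ : κ = 0
  · have h2 (u : F) : u ^ (2 : ℤ) = u ^ 2 := by norm_cast
    simp only [exchangePoly, hκ, if_true, h2, Polynomial.eval₂_add, Polynomial.eval₂_one,
      Polynomial.eval₂_X, Nat.cast_zero]
    field_simp
    ring
  · simp only [exchangePoly, hκ, if_false, zpow_one, Polynomial.eval₂_add, Polynomial.eval₂_one,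
      Polynomial.eval₂_mul, Polynomial.eval₂_C, Polynomial.eval₂_pow, Polynomial.eval₂_X,
      Nat.coe_castRingHom]
    field_simp
    ring

/-- The exchange relations. -/
theorem mutate_x_self {k : Fin 3 → ℕ} {s : Seed 3 RatFun}
    (hZ : s.Z = fun i => exchangePoly (k i))
    (hB : s.B = initialB k ∨ s.B = -initialB k) (hx : ∀ i, s.x i ≠ 0) {i j h : Fin 3}
    (hij : i ≠ j) (hih : i ≠ h) (hjh : j ≠ h) :
    (s.mutate i).x i
      = (s.x i)⁻¹ * (s.x j ^ 2 + k i * (s.x j * s.x h) + s.x h ^ 2) := by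
  have hd : s.d i = if k i = 0 then 1 else 2 := by
    rw [Seed.d, hZ, natDegree_exchangePoly]
  have hs : s.x j ^ 2 + k i * (s.x j * s.x h) + s.x h ^ 2
      = s.x (i + 1) ^ 2 + k i * (s.x (i + 1) * s.x (i + 2)) + s.x (i + 2) ^ 2 := by
    have : j = i + 1 ∧ h = i + 2 ∨ j = i + 2 ∧ h = i + 1 := by
      clear hd hB hZ
      revert i j h; decide
    rcases this with ⟨rfl, rfl⟩ | ⟨rfl, rfl⟩ <;> ring
  simp only [Seed.mutate, Function.update_self, hd, hZ]
  rw [mul_assoc, hs]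
  congr 1
  rcases hB with hB | hB <;> simp only [hB, Matrix.neg_apply, neg_neg]
  · rw [prod_zpow_max_neg_initialB, prod_zpow_initialB, pow_mul_eval₂_exchangePoly _ _ (hx _)]
  -- Reversing the sign of `B` swaps the two neighbours, and the exchange numerator is symmetric in
  -- them.
  · simp only [zpow_neg, Finset.prod_inv_distrib]
    rw [prod_zpow_max_initialB, prod_zpow_initialB, inv_div,
      pow_mul_eval₂_exchangePoly _ _ (hx _)]
    ring

theorem mutate_x_of_ne (s : Seed 3 RatFun) {i j : Fin 3} (h : j ≠ i) :
    (s.mutate i).x j = s.x j := by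
  simp [Seed.mutate, h]

/-- The properties shared by all the labeled seeds of `𝒜(k₁, k₂, k₃)`. -/
structure IsGood (k : Fin 3 → ℕ) (s : Seed 3 RatFun) : Prop where
  Z_eq : s.Z = fun i => exchangePoly (k i)
  B_eq : s.B = initialB k ∨ s.B = -initialB k
  -- This parity invariant separates the three positions.
  grows : ∀ (w : Fin 3 → ℤ) (i : Fin 3), ∃ d, RatGrows w (s.x i) (w i + 2 * d)
  markov : ∀ i j h : Fin 3, i ≠ j → i ≠ h → j ≠ h →
    algebraMap Laurent RatFun (markovInvariant k) * s.x i * s.x j * s.x h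
      = s.x i ^ 2 + s.x j ^ 2 + s.x h ^ 2 + k i * (s.x j * s.x h) + k j * (s.x i * s.x h)
        + k h * (s.x i * s.x j)

theorem IsGood.x_ne_zero {k : Fin 3 → ℕ} {s : Seed 3 RatFun} (hs : IsGood k s) (i : Fin 3) :
    s.x i ≠ 0 :=
  (hs.grows 0 i).choose_spec.ne_zero

theorem IsGood.mutate_x_self {k : Fin 3 → ℕ} {s : Seed 3 RatFun} (hs : IsGood k s) {i j h : Fin 3}
    (hij : i ≠ j) (hih : i ≠ h) (hjh : j ≠ h) :
    (s.mutate i).x i = (s.x i)⁻¹ * (s.x j ^ 2 + k i * (s.x j * s.x h) + s.x h ^ 2) :=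
  GenMarkov.mutate_x_self hs.Z_eq hs.B_eq hs.x_ne_zero hij hih hjh

/-- The exchange relation in Vieta form. -/
theorem IsGood.mutate_x_self_add {k : Fin 3 → ℕ} {s : Seed 3 RatFun} (hs : IsGood k s)
    {i j h : Fin 3} (hij : i ≠ j) (hih : i ≠ h) (hjh : j ≠ h) :
    (s.mutate i).x i + s.x i = algebraMap Laurent RatFun (markovInvariant k) * s.x j * s.x h
      - k j * s.x h - k h * s.x j := by
  have hm := hs.markov i j h hij hih hjh
  rw [hs.mutate_x_self hij hih hjh]
  refine mul_left_cancel₀ (hs.x_ne_zero i) ?_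
  rw [mul_add, mul_inv_cancel_left₀ (hs.x_ne_zero i)]
  linear_combination -hm

theorem markovInvariant_mul (k : Fin 3 → ℕ) :
    markovInvariant k * (var 0 * var 1 * var 2)
      = var 0 ^ 2 + var 1 ^ 2 + var 2 ^ 2 + (k 0 : Laurent) * var 1 * var 2
        + (k 1 : Laurent) * var 0 * var 2 + (k 2 : Laurent) * var 0 * var 1 := by
  have h : monomial (fun _ => -1) * (var 0 * var 1 * var 2) = 1 := by
    simp only [var, monomial, AddMonoidAlgebra.single_mul_single, AddMonoidAlgebra.one_def]
    congr 1
    · ext i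
      fin_cases i <;> simp
  rw [markovInvariant, mul_assoc, h, mul_one]

theorem isGood_initialSeed (k : Fin 3 → ℕ) : IsGood k (initialSeed k) where
  Z_eq := rfl
  B_eq := Or.inl rfl
  grows w i := ⟨0, by simpa [initialSeed] using (Grows.var w i).ratGrows⟩
  markov := by
    have h := congrArg (algebraMap Laurent RatFun) (markovInvariant_mul k)
    simp only [map_mul, map_add, map_pow, map_natCast] at h
    intro i j l hij hil hjl
    simp only [initialSeed]
    fin_cases i <;> fin_cases j <;> fin_cases l <;> simp at hij hil hjl <;>
      simp <;> linear_combination h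

theorem Fin.exists_ne_ne (i : Fin 3) : ∃ j h : Fin 3, i ≠ j ∧ i ≠ h ∧ j ≠ h := by
  revert i; decide

theorem IsGood.mutate {k : Fin 3 → ℕ} {s : Seed 3 RatFun} (hs : IsGood k s) (l : Fin 3) :
    IsGood k (s.mutate l) where
  Z_eq := by
    simp only [Seed.mutate, hs.Z_eq, reverse_exchangePoly]
    exact Function.update_eq_self l _
  B_eq := by
    rw [mutate_initialB hs.Z_eq hs.B_eq]
    rcases hs.B_eq with h | h <;> simp [h]
  grows w i := by
    by_cases hi : i = l
    · subst hi
      obtain ⟨j, h, hij, hih, hjh⟩ := Fin.exists_ne_ne i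
      obtain ⟨d, hd⟩ := hs.grows w i
      obtain ⟨e, he⟩ := hs.grows w j
      obtain ⟨f, hf⟩ := hs.grows w h
      rw [hs.mutate_x_self hij hih hjh]
      -- Solves `2 * max _ _ - (w i + 2 * d) = w i + 2 * d'` for `d'`.
      refine ⟨max (w j + 2 * e) (w h + 2 * f) - w i - d, ?_⟩
      convert hd.inv.mul (he.exchange hf (k i)) using 1
      ring
    · rw [mutate_x_of_ne s hi]
      exact hs.grows w i
  markov := by
    -- The equation is symmetric in the positions, so the mutated one may come first.
    suffices H : ∀ j h : Fin 3, l ≠ j → l ≠ h → j ≠ h →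
        algebraMap Laurent RatFun (markovInvariant k)
            * (s.mutate l).x l * (s.mutate l).x j * (s.mutate l).x h
          = (s.mutate l).x l ^ 2 + (s.mutate l).x j ^ 2 + (s.mutate l).x h ^ 2
            + k l * ((s.mutate l).x j * (s.mutate l).x h)
            + k j * ((s.mutate l).x l * (s.mutate l).x h)
            + k h * ((s.mutate l).x l * (s.mutate l).x j) by
      intro a b c hab hac hbc
      have : l = a ∨ l = b ∨ l = c := by omega
      rcases this with rfl | rfl | rfl
      · exact H b c hab hac hbc
      · linear_combination H a c hab.symm hbc hac
      · linear_combination H a b hac.symm hbc.symm hab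
    intro j h hlj hlh hjh
    rw [mutate_x_of_ne s hlj.symm, mutate_x_of_ne s hlh.symm]
    -- Product and sum of the old and new variables: both are roots of the same quadratic.
    have h1 := hs.mutate_x_self hlj hlh hjh
    rw [eq_inv_mul_iff_mul_eq₀ (hs.x_ne_zero l)] at h1
    have h2 := hs.mutate_x_self_add hlj hlh hjh
    linear_combination -(s.mutate l).x l * h2 + h1

theorem isGood_of_inPattern {k : Fin 3 → ℕ} {s : Seed 3 RatFun}
    (hs : (initialSeed k).InPattern s) : IsGood k s := by
  induction hs with
  | init => exact isGood_initialSeed k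
  | mutate s i _ ih => exact ih.mutate i

/-- The position of a cluster variable is unique. -/
theorem IsClusterVariableAt.unique {k : Fin 3 → ℕ} {z : RatFun} {i j : Fin 3}
    (hi : IsClusterVariableAt k i z) (hj : IsClusterVariableAt k j z) : i = j := by
  obtain ⟨s, hs, rfl⟩ := hi
  obtain ⟨s', hs', h⟩ := hj
  by_contra hne
  -- With this weight the exponent is odd at position `i` and even at the others.
  obtain ⟨d, hd⟩ := (isGood_of_inPattern hs).grows (Pi.single i 1) i
  obtain ⟨e, he⟩ := (isGood_of_inPattern hs').grows (Pi.single i 1) j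
  rw [h] at he
  have := hd.unique he
  rw [Pi.single_eq_same, Pi.single_eq_of_ne (Ne.symm hne)] at this
  omega

theorem IsClusterVariableAt.parity_eq {k : Fin 3 → ℕ} {z : RatFun} {i : Fin 3}
    (hi : IsClusterVariableAt k i z) : parity k z = k i := by
  have h : IsClusterVariable k z := ⟨i, hi⟩
  rw [parity, dif_pos h, h.choose_spec.unique hi]

/-- Mutation of the middle component of a non-labeled cluster. -/
theorem IsNonlabeledCluster.mutate_middle {k : Fin 3 → ℕ} {a b c : RatFun}
    (h : IsNonlabeledCluster k a b c) {b' : RatFun}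
    (hb' : b' = algebraMap Laurent RatFun (markovInvariant k) * a * c
      - parity k a * c - parity k c * a - b) :
    IsNonlabeledCluster k a b' c ∧ IsClusterVariable k b' ∧ parity k b' = parity k b := by
  obtain ⟨s, hs, σ, rfl, rfl, rfl⟩ := h
  have hne : ∀ {i j : Fin 3}, i ≠ j → σ i ≠ σ j := fun h => σ.injective.ne h
  have hpar : ∀ i, parity k (s.x i) = k i := fun i =>
    IsClusterVariableAt.parity_eq ⟨s, hs, rfl⟩
  have hv := (isGood_of_inPattern hs).mutate_x_self_add (hne (i := 1) (j := 0) (by decide))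
    (hne (i := 1) (j := 2) (by decide)) (hne (i := 0) (j := 2) (by decide))
  have hb : (s.mutate (σ 1)).x (σ 1) = b' := by
    rw [hb', hpar, hpar]
    linear_combination hv
  have hat : IsClusterVariableAt k (σ 1) b' := ⟨_, hs.mutate s (σ 1), hb⟩
  refine ⟨⟨_, hs.mutate s (σ 1), σ, ?_, hb, ?_⟩, ⟨_, hat⟩, by rw [hat.parity_eq, hpar]⟩
  · exact mutate_x_of_ne s (hne (by decide))
  · exact mutate_x_of_ne s (hne (by decide))

/-! ### The decomposition -/

/-- The monodromy matrix `T`. -/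
noncomputable def monodromy (k : Fin 3 → ℕ) : SL2 :=
  ⟨!![-1, 0; markovInvariant k, -1], by simp [Matrix.det_fin_two]⟩

theorem coe_monodromy (k : Fin 3 → ℕ) : (monodromy k : Matrix (Fin 2) (Fin 2) Laurent)
    = !![-1, 0; markovInvariant k, -1] := rfl

/-- Left multiplication by `-T` is a row operation that fixes the first row. -/
theorem neg_monodromy_mul_apply (k : Fin 3 → ℕ) (P : SL2) :
    ((-(monodromy k * P) : SL2) : Matrix (Fin 2) (Fin 2) Laurent) 0 1
      = P.1 0 1 := by
  simp only [Matrix.SpecialLinearGroup.coe_neg,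
    Matrix.SpecialLinearGroup.coe_mul, coe_monodromy, Matrix.neg_apply, Matrix.mul_apply,
    Fin.sum_univ_two, Matrix.of_apply, Matrix.cons_val_zero, Matrix.cons_val_one,
    Matrix.cons_val', Matrix.cons_val_fin_one]
  ring

theorem trace_neg_monodromy_mul (k : Fin 3 → ℕ) (P : SL2) :
    ((-(monodromy k * P) : SL2) : Matrix (Fin 2) (Fin 2) Laurent).trace
      = P.1.trace - markovInvariant k * P.1 0 1 := by
  simp only [Matrix.trace_fin_two, Matrix.SpecialLinearGroup.coe_neg,
    Matrix.SpecialLinearGroup.coe_mul, coe_monodromy, Matrix.neg_apply, Matrix.mul_apply,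
    Fin.sum_univ_two, Matrix.of_apply, Matrix.cons_val_zero, Matrix.cons_val_one,
    Matrix.cons_val', Matrix.cons_val_fin_one]
  ring

/-- Right multiplication by `-T` is a column operation that fixes the second column. -/
theorem neg_mul_monodromy_apply (k : Fin 3 → ℕ) (P : SL2) :
    ((-(P * monodromy k) : SL2) : Matrix (Fin 2) (Fin 2) Laurent) 0 1
      = P.1 0 1 := by
  simp only [Matrix.SpecialLinearGroup.coe_neg,
    Matrix.SpecialLinearGroup.coe_mul, coe_monodromy, Matrix.neg_apply, Matrix.mul_apply,
    Fin.sum_univ_two, Matrix.of_apply, Matrix.cons_val_zero, Matrix.cons_val_one,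
    Matrix.cons_val', Matrix.cons_val_fin_one]
  ring

theorem trace_neg_mul_monodromy (k : Fin 3 → ℕ) (P : SL2) :
    ((-(P * monodromy k) : SL2) : Matrix (Fin 2) (Fin 2) Laurent).trace
      = P.1.trace - markovInvariant k * P.1 0 1 := by
  simp only [Matrix.trace_fin_two, Matrix.SpecialLinearGroup.coe_neg,
    Matrix.SpecialLinearGroup.coe_mul, coe_monodromy, Matrix.neg_apply, Matrix.mul_apply,
    Fin.sum_univ_two, Matrix.of_apply, Matrix.cons_val_zero, Matrix.cons_val_one,
    Matrix.cons_val', Matrix.cons_val_fin_one]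
  ring

theorem IsCGCMatrix.neg_monodromy_mul {k : Fin 3 → ℕ} {P : SL2} (hP : IsCGCMatrix k P) :
    IsCMMMatrix k (-(monodromy k * P)) := by
  have h : entry12 (-(monodromy k * P)) = entry12 P := by
    rw [entry12, neg_monodromy_mul_apply, entry12]
  refine ⟨h ▸ hP.isClusterVariable, ?_⟩
  rw [h, trace_neg_monodromy_mul, hP.trace_eq]
  ring

theorem IsCGCMatrix.neg_mul_monodromy {k : Fin 3 → ℕ} {P : SL2} (hP : IsCGCMatrix k P) :
    IsCMMMatrix k (-(P * monodromy k)) := by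
  have h : entry12 (-(P * monodromy k)) = entry12 P := by
    rw [entry12, neg_mul_monodromy_apply, entry12]
  refine ⟨h ▸ hP.isClusterVariable, ?_⟩
  rw [h, trace_neg_mul_monodromy, hP.trace_eq]
  ring

/-! ### Matrix identities for CGC triples -/

section

variable {k : Fin 3 → ℕ} {P Q R : SL2}

theorem IsCGCTriple.apply_zero_one (h : IsCGCTriple k P Q R) :
    Q.1 0 1 = P.1 0 0 * R.1 0 1 + P.1 0 1 * R.1 1 1 := by
  have := congrFun (congrFun h.eq_mul_sub 0) 1
  simpa [matS, Matrix.mul_apply, Fin.sum_univ_two] using this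

/-- The trace condition on `Q` identifies the scalar in `S_Q` as the parity of its (1,2)-entry. -/
theorem IsCGCTriple.coe_mul (h : IsCGCTriple k P Q R) :
    P.1 * R.1 = Q.1 + (parity k (entry12 Q) : Laurent) • !![1, 0; markovInvariant k, 1] := by
  have h1 : P.1 * R.1 = Q.1 + matS k Q.1 := by
    have := h.eq_mul_sub
    rw [eq_sub_iff_add_eq] at this
    exact this.symm
  rw [h1, matS, h.middle.trace_eq]
  congr 1
  ext i j
  fin_cases i <;> fin_cases j <;> simp

/-- The right-hand side is the Vieta partner of the middle variable, so `Y` carries the mutated one.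
-/
theorem IsCGCTriple.inv_apply (h : IsCGCTriple k P Q R) :
    ((R * monodromy k * P)⁻¹ : SL2).1 0 1
      = markovInvariant k * P.1 0 1 * R.1 0 1 - parity k (entry12 P) * R.1 0 1
        - parity k (entry12 R) * P.1 0 1 - Q.1 0 1 := by
  have hP := h.left.trace_eq
  have hR := h.right.trace_eq
  have hQ := h.apply_zero_one
  rw [Matrix.trace_fin_two] at hP hR
  simp only [Matrix.SpecialLinearGroup.coe_inv, Matrix.SpecialLinearGroup.coe_mul,
    Matrix.adjugate_fin_two, coe_monodromy, Matrix.mul_apply, Fin.sum_univ_two, Matrix.of_apply,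
    Matrix.cons_val_zero, Matrix.cons_val_one, Matrix.cons_val', Matrix.cons_val_fin_one]
  linear_combination R.1 0 1 * hP + P.1 0 1 * hR + hQ

/-- A determinant-one 2×2 matrix and its inverse have equal trace; cyclicity then brings in the
product `PR`. -/
theorem IsCGCTriple.trace_inv (h : IsCGCTriple k P Q R) :
    ((R * monodromy k * P)⁻¹ : SL2).1.trace = -(parity k (entry12 Q) : Laurent) := by
  have h1 : ((R * monodromy k * P)⁻¹ : SL2).1.trace = ((monodromy k).1 * (P.1 * R.1)).trace := by
    rw [← Matrix.mul_assoc, Matrix.trace_mul_comm, ← Matrix.mul_assoc]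
    simp only [Matrix.SpecialLinearGroup.coe_inv, Matrix.SpecialLinearGroup.coe_mul,
      Matrix.adjugate_fin_two, Matrix.trace_fin_two, Matrix.of_apply,
      Matrix.cons_val_zero, Matrix.cons_val_one, Matrix.cons_val', Matrix.cons_val_fin_one]
    exact add_comm _ _
  have hQ := h.middle.trace_eq
  rw [Matrix.trace_fin_two] at hQ
  rw [h1, h.coe_mul]
  simp only [Matrix.trace_fin_two, coe_monodromy, Matrix.mul_apply, Matrix.add_apply,
    Matrix.smul_apply, smul_eq_mul, Fin.sum_univ_two, Matrix.of_apply, Matrix.cons_val_zero,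
    Matrix.cons_val_one, Matrix.cons_val', Matrix.cons_val_fin_one]
  linear_combination -hQ

/-- Since `!![1, 0; M, 1] = -T⁻¹`, `coe_mul` reads `PR = Q - κ T⁻¹`. Hence `T(PR)TQ = (TQ)² - κ TQ`,
which is `-1` by Cayley–Hamilton: `TQ` has determinant 1 and trace `κ`. -/
theorem IsCGCTriple.middle_eq (h : IsCGCTriple k P Q R) :
    Q = -(monodromy k * (P * R) * monodromy k)⁻¹ := by
  have key : monodromy k * (P * R) * monodromy k * Q = -1 := by
    apply Subtype.ext
    have hQ := h.middle.trace_eq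
    have hdet := Q.2
    rw [Matrix.trace_fin_two] at hQ
    rw [Matrix.det_fin_two] at hdet
    change (monodromy k).1 * (P.1 * R.1) * (monodromy k).1 * Q.1 = -1
    rw [h.coe_mul]
    generalize (parity k (entry12 Q) : Laurent) = κ at *
    generalize hm : markovInvariant k = m at *
    -- With `κ` eliminated, each entry is a polynomial identity modulo `det Q = 1`.
    have hκ : κ = m * Q.1 0 1 - (Q.1 0 0 + Q.1 1 1) := by linear_combination hQ
    rw [hκ]
    refine Matrix.ext fun i j => ?_
    fin_cases i <;> fin_cases j <;>
      simp only [coe_monodromy, hm, Matrix.mul_apply, Matrix.add_apply, Matrix.neg_apply,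
        Matrix.smul_apply, smul_eq_mul, Fin.sum_univ_two, Matrix.of_apply, Matrix.cons_val_zero,
        Matrix.cons_val_one, Matrix.cons_val', Matrix.cons_val_fin_one, Fin.zero_eta, Fin.mk_one,
        Matrix.one_apply_eq, Matrix.one_apply_ne, ne_eq, zero_ne_one, one_ne_zero,
        not_false_eq_true]
    · linear_combination -hdet
    · ring
    · ring
    · linear_combination -hdet
  rw [← inv_mul_cancel_left (monodromy k * (P * R) * monodromy k) Q, key]
  simp

end

theorem IsCGCTripleAssociated.isMMDecomposition {k : Fin 3 → ℕ} {P Q R : SL2} {a b c : Laurent}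
    (h : IsCGCTripleAssociated k P Q R a b c) :
    IsMMDecomposition k P Q R a b c (-(monodromy k * P)) (R * monodromy k * P)⁻¹
      (-(R * monodromy k)) := by
  obtain ⟨h, rfl, rfl, rfl⟩ := h
  have hX : entry12 (-(monodromy k * P)) = entry12 P := by
    rw [entry12, neg_monodromy_mul_apply, entry12]
  have hZ : entry12 (-(R * monodromy k)) = entry12 R := by
    rw [entry12, neg_mul_monodromy_apply, entry12]
  have hY : entry12 (R * monodromy k * P)⁻¹
      = algebraMap Laurent RatFun (markovInvariant k) * entry12 P * entry12 R
        - parity k (entry12 P) * entry12 R - parity k (entry12 R) * entry12 P - entry12 Q := by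
    rw [entry12, h.inv_apply]
    simp only [map_sub, map_mul, map_natCast]
    rfl
  obtain ⟨hcl, hvar, hpar⟩ := h.isCluster.mutate_middle hY
  exact {
    isCMMTriple := {
      left := h.left.neg_monodromy_mul
      -- Mutation keeps the position, so the entry of `Y` has the same parity as `b`.
      middle := ⟨hvar, by rw [hpar]; exact h.trace_inv⟩
      right := h.right.neg_mul_monodromy
      mul_eq := by
        rw [← coe_monodromy]
        refine congrArg Subtype.val (?_ : _ = monodromy k)
        rw [neg_mul, neg_mul_neg]
        group
      isCluster := by rwa [hX, hZ] }
    left_eq := by rw [mul_neg, inv_neg, neg_neg]; group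
    middle_eq := by
      rw [neg_mul_neg]
      convert h.middle_eq using 3
      group
    right_eq := by rw [neg_mul, inv_neg, neg_neg]; group
    trace_left := by
      rw [trace_neg_monodromy_mul, h.left.trace_eq, entry12]
      ring
    trace_middle := h.trace_inv
    trace_right := by
      rw [trace_neg_mul_monodromy, h.right.trace_eq, entry12]
      ring }

/-- After substituting `T = XYZ` and the formulas for `P` and `R`, only group identities remain. -/
theorem IsMMDecomposition.eq {k : Fin 3 → ℕ} {P Q R : SL2} {a b c : Laurent} {X Y Z : SL2}
    (h : IsMMDecomposition k P Q R a b c X Y Z) :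
    X = -(monodromy k * P) ∧ Y = (R * monodromy k * P)⁻¹ ∧ Z = -(R * monodromy k) := by
  have hT : monodromy k = X * Y * Z := Subtype.ext h.isCMMTriple.mul_eq.symm
  rw [h.left_eq, h.right_eq, hT]
  refine ⟨?_, ?_, ?_⟩
  · rw [mul_neg, neg_neg]; group
  · rw [mul_neg, neg_mul, neg_mul, neg_neg]; group
  · rw [neg_mul, neg_neg]; group

end GenMarkov

theorem mainTheorem9 (k : Fin 3 → ℕ) (P Q R : GenMarkov.SL2) (a b c : GenMarkov.Laurent)
    (h : GenMarkov.IsCGCTripleAssociated k P Q R a b c)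
    (hb : max (GenMarkov.atOne a) (GenMarkov.atOne c) < GenMarkov.atOne b) :
    ∃! t : GenMarkov.SL2 × GenMarkov.SL2 × GenMarkov.SL2,
      GenMarkov.IsMMDecomposition k P Q R a b c t.1 t.2.1 t.2.2 := by
  refine ⟨(_, _, _), h.isMMDecomposition, fun t ht => ?_⟩
  obtain ⟨hX, hY, hZ⟩ := ht.eq
  exact Prod.ext hX (Prod.ext hY hZ)
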